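/- Let $\Gamma$ be a finite perfect group (that is, $\Gamma$ has no non-trivial abelian quotient; equivalently $[\Gamma,\Gamma]=\Gamma$), and let $\mathbb{G}=\widehat{\Gamma}$ be its dual quantum group: $C(\mathbb{G})=\mathbb{C}[\Gamma]$ with $g^*=g^{-1}$, comultiplication $\Delta(g)=g\otimes g$ and antipode $S(g)=g^{-1}$ for $g\in\Gamma$, regarded as a finite quantum set through the functional $\psi\bigl(\sum_g c_g g\bigr)=|\Gamma|\,c_1$. With the inner product $\langle x,y\rangle=\psi(x^*y)$, the multiplication $m$ satisfies $mm^*=\mathrm{id}$. A (directed) quantum graph on $\mathbb{G}$ is a linear map $A:C(\mathbb{G})\to C(\mathbb{G})$ with $m(A\otimes A)m^*=A$ and $A(f^*)^*=A(f)$ for all $f$. Then there is a quantum graph $A$ on $\mathbb{G}$ with the following properties. 1. It is a quantum Cayley graph: there is an orthogonal projection $P\in C(\mathbb{G})$ with $A(x)=P\star x:=(\psi(S(P)\,\cdot\,)\otimes\mathrm{id})\Delta(x)$ for all $x\in C(\mathbb{G})$. 2. Its classical automorphism group is trivial: the identity is the only $*$-automorphism of $C(\mathbb{G})$ that commutes with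 $A$. 3. Its quantum automorphism group is $\widehat{\Gamma}$, acting on $C(\mathbb{G})$ by $\Delta$. That is, $\Delta$ is a faithful action of $\widehat{\Gamma}$ on $C(\mathbb{G})$ that preserves $\psi$ and commutes with $A$, meaning $(\psi\otimes\mathrm{id})\Delta=\psi(\cdot)1$ and $(A\otimes\mathrm{id})\Delta=\Delta A$. Moreover, for every compact quantum group $\mathbb{H}$ and every action $\beta:C(\mathbb{G})\to C(\mathbb{G})\otimes\mathcal{O}(\mathbb{H})$ that preserves $\psi$ and commutes with $A$ in the same sense, there is a unique Hopf $*$-algebra morphism $\gamma:\mathbb{C}[\Gamma]\to\mathcal{O}(\mathbb{H})$ with $(\mathrm{id}\otimes\gamma)\Delta=\beta$. 4. This action of the quantum automorphism group is ergodic (transitive): $\{x\in C(\mathbb{G}):\Delta(x)=x\otimes 1\}=\mathbb{C}1$. -/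

import Mathlib

open scoped TensorProduct

universe u v

noncomputable section

/-! ### Finite quantum sets and quantum graphs -/

section QuantumSets

open scoped ComplexOrder

/-- A finite quantum set: a finite-dimensional unital complex `*`-algebra `B = C(𝕏)` with its
tracial `1`-form `ψ`, i.e. a tracial faithful positive functional such that `m m^* = id`, where
`m : B ⊗ B → B` is the multiplication and `m^*` is its adjoint for the inner products
`⟨x, y⟩ = ψ (x^* y)` on `B` and `⟨x ⊗ y, x' ⊗ y'⟩ = ψ (x^* x') ψ (y^* y')` on `B ⊗ B`.
(A finite-dimensional `*`-algebra with a faithful positive functional is a C*-algebra for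
a unique norm; `mulAdj` is determined by `ψ` because the inner product is non-degenerate.) -/
structure QuantumSet (B : Type*) [Ring B] [StarRing B] [Algebra ℂ B] [StarModule ℂ B] where
  finiteDimensional : FiniteDimensional ℂ B
  /-- the tracial `1`-form -/
  ψ : B →ₗ[ℂ] ℂ
  tracial : ∀ x y : B, ψ (x * y) = ψ (y * x)
  pos : ∀ x : B, x ≠ 0 → 0 < ψ (star x * x)
  /-- the adjoint `m^*` of the multiplication -/
  mulAdj : B →ₗ[ℂ] B ⊗[ℂ] B
  mulAdj_adjoint : ∀ x y z : B,
    LinearMap.mul' ℂ ℂ (TensorProduct.map ψ ψ (star (x ⊗ₜ[ℂ] y) * mulAdj z))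
      = ψ (star (x * y) * z)
  mul_mulAdj : ∀ z : B, LinearMap.mul' ℂ B (mulAdj z) = z

variable {B : Type*} [Ring B] [StarRing B] [Algebra ℂ B] [StarModule ℂ B]

/-- The Schur product `S • T = m (S ⊗ T) m^*`. -/
def QuantumSet.schur (X : QuantumSet B) (S T : B →ₗ[ℂ] B) : B →ₗ[ℂ] B :=
  LinearMap.mul' ℂ B ∘ₗ TensorProduct.map S T ∘ₗ X.mulAdj

/-- A (directed) quantum graph on the quantum set `X`: a quantum adjacency matrix, i.e. a
Schur idempotent `A` that is real, `A f = (A (f^*))^*`. -/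
structure QuantumGraph (X : QuantumSet B) where
  A : B →ₗ[ℂ] B
  schur_idempotent : X.schur A A = A
  real : ∀ f : B, star (A (star f)) = A f

/-- The classical automorphism group of a quantum graph: the `*`-automorphisms of `C(𝕏)` that
commute with the quantum adjacency matrix. -/
def QuantumGraph.classicalAut {X : QuantumSet B} (G : QuantumGraph X) :
    Subgroup (B ≃⋆ₐ[ℂ] B) where
  carrier := {θ | ∀ x, θ (G.A x) = G.A (θ x)}
  one_mem' := fun _ => rfl
  mul_mem' := by
    intro a b ha hb x
    change ∀ x, a (G.A x) = G.A (a x) at ha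
    change ∀ x, b (G.A x) = G.A (b x) at hb
    rw [StarAlgEquiv.mul_apply, StarAlgEquiv.mul_apply, hb, ha]
  inv_mem' := by
    intro a ha x
    change ∀ x, a (G.A x) = G.A (a x) at ha
    change a.symm (G.A x) = G.A (a.symm x)
    have h := ha (a.symm x)
    rw [StarAlgEquiv.apply_symm_apply] at h
    rw [← h, StarAlgEquiv.symm_apply_apply]

end QuantumSets

/-! ### Compact quantum groups and their actions -/

/-- A unitary `n × n` matrix over a Hopf `*`-algebra `H` that is a (co)representation:
`Δ (u i j) = ∑ k, u i k ⊗ u k j`. -/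
structure IsUnitaryCorep {H : Type*} [Ring H] [StarRing H] [HopfAlgebra ℂ H]
    {n : ℕ} (u : Matrix (Fin n) (Fin n) H) : Prop where
  comul : ∀ i j, Coalgebra.comul (R := ℂ) (u i j) = ∑ k, u i k ⊗ₜ[ℂ] u k j
  unitary : u ∈ unitary (Matrix (Fin n) (Fin n) H)

/-- `H = 𝒪(ℍ)` is a CQG-Hopf `*`-algebra, i.e. the algebra of a compact quantum group `ℍ`:
a Hopf `*`-algebra spanned by the matrix coefficients of its unitary finite-dimensional
(co)representations. -/
class IsCompactQuantumGroup (H : Type*) [Ring H] [StarRing H] [HopfAlgebra ℂ H]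
    [StarModule ℂ H] : Prop where
  comul_star : ∀ x : H, Coalgebra.comul (R := ℂ) (star x) = star (Coalgebra.comul (R := ℂ) x)
  counit_star : ∀ x : H,
    Coalgebra.counit (R := ℂ) (star x) = star (Coalgebra.counit (R := ℂ) x)
  span_coeff : Submodule.span ℂ {x : H | ∃ (n : ℕ) (u : Matrix (Fin n) (Fin n) H),
    IsUnitaryCorep u ∧ ∃ i j, x = u i j} = ⊤

section Actions

variable {B : Type*} [Ring B] [StarRing B] [Algebra ℂ B] [StarModule ℂ B]
  {H : Type*} [Ring H] [StarRing H] [HopfAlgebra ℂ H] [StarModule ℂ H]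

/-- An action of the compact quantum group with algebra `H` on the algebra `B`: an injective unital
`*`-homomorphism `α : B → B ⊗ H` with `(α ⊗ id) α = (id ⊗ Δ) α`. -/
structure QuantumAction (B H : Type*) [Ring B] [StarRing B] [Algebra ℂ B] [StarModule ℂ B]
    [Ring H] [StarRing H] [HopfAlgebra ℂ H] [StarModule ℂ H] where
  hom : B →⋆ₐ[ℂ] B ⊗[ℂ] H
  injective : Function.Injective hom
  action_eq : ∀ x : B,
    TensorProduct.assoc ℂ B H H (LinearMap.rTensor H hom.toAlgHom.toLinearMap (hom x))
      = LinearMap.lTensor B (Coalgebra.comul (R := ℂ) (A := H)) (hom x)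

/-- The action is faithful: the slices `(ω ⊗ id) (α a)` generate `H` as a Hopf `*`-algebra. -/
def QuantumAction.IsFaithful (α : QuantumAction B H) : Prop :=
  ∀ S : StarSubalgebra ℂ H,
    (∀ (ω : B →ₗ[ℂ] ℂ) (a : B), TensorProduct.lid ℂ H (LinearMap.rTensor H ω (α.hom a)) ∈ S) →
    (∀ x ∈ S, HopfAlgebra.antipode ℂ x ∈ S) →
    (∀ x ∈ S, Coalgebra.comul (R := ℂ) x ∈ LinearMap.range
      (TensorProduct.map S.subtype.toAlgHom.toLinearMap S.subtype.toAlgHom.toLinearMap)) →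
    S = ⊤

/-- The action is ergodic (transitive): its fixed point algebra is `ℂ 1`. -/
def QuantumAction.IsErgodic (α : QuantumAction B H) : Prop :=
  {x : B | α.hom x = x ⊗ₜ[ℂ] (1 : H)} = Set.range (algebraMap ℂ B)

/-- The action `α` on `C(𝕏)` is an action on the quantum graph `G`: it preserves `ψ`,
`(ψ ⊗ id) α = ψ(·) 1`, and the adjacency matrix, `(A ⊗ id) α = α A`. -/
structure QuantumGraph.IsPreservedBy {X : QuantumSet B} (G : QuantumGraph X)
    (α : QuantumAction B H) : Prop where
  functional : ∀ x : B,
    TensorProduct.lid ℂ H (LinearMap.rTensor H X.ψ (α.hom x)) = X.ψ x • (1 : H)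
  adjacency : ∀ x : B, LinearMap.rTensor H G.A (α.hom x) = α.hom (G.A x)

end Actions

/-- The compact quantum group with algebra `H`, acting by `α`, is the quantum automorphism group
of the quantum graph `G`: it acts faithfully on `G`, and for every action `β` of a compact quantum
group, with algebra `K`, on `G` there is a unique Hopf `*`-algebra morphism `γ : H → K` with
`(id ⊗ γ) α = β`. (A bialgebra morphism between Hopf algebras preserves the antipode.) -/
structure QuantumGraph.IsQuantumAutGroup.{w, u₁, u₂} {B : Type u₁} [Ring B] [StarRing B]
    [Algebra ℂ B] [StarModule ℂ B] {X : QuantumSet B} (G : QuantumGraph X)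
    {H : Type u₂} [Ring H] [StarRing H] [HopfAlgebra ℂ H] [StarModule ℂ H]
    (α : QuantumAction B H) : Prop where
  compactQuantumGroup : IsCompactQuantumGroup H
  preserved : G.IsPreservedBy α
  faithful : α.IsFaithful
  universal : ∀ (K : Type w) [Ring K] [StarRing K] [HopfAlgebra ℂ K] [StarModule ℂ K]
    [IsCompactQuantumGroup K] (β : QuantumAction B K), G.IsPreservedBy β →
    ∃! γ : H →ₐc[ℂ] K, (∀ x, γ (star x) = star (γ x)) ∧
      ∀ x, LinearMap.lTensor B (γ : H →ₗ[ℂ] K) (α.hom x) = β.hom x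

/-! ### Finite quantum groups: action on themselves, convolution, Cayley graphs -/

section QuantumGroups

variable {H : Type*} [Ring H] [StarRing H] [HopfAlgebra ℂ H] [StarModule ℂ H]

/-- The action of a quantum group on itself, given by the comultiplication. -/
def QuantumAction.regular (H : Type*) [Ring H] [StarRing H] [HopfAlgebra ℂ H] [StarModule ℂ H]
    [IsCompactQuantumGroup H] : QuantumAction H H where
  hom := { Bialgebra.comulAlgHom ℂ H with
    map_star' := fun x => IsCompactQuantumGroup.comul_star x }
  injective := by
    intro x y hxy
    have hxy' : Coalgebra.comul (R := ℂ) x = Coalgebra.comul (R := ℂ) y := hxy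
    have h := congrArg (fun z => TensorProduct.lid ℂ H
      (LinearMap.rTensor H (Coalgebra.counit (R := ℂ) (A := H)) z)) hxy'
    simpa using h
  action_eq := fun x => Coalgebra.coassoc_apply (R := ℂ) x

/-- The convolution operator `L_ω = (ω ⊗ id) Δ`. -/
def leftConv (ω : H →ₗ[ℂ] ℂ) : H →ₗ[ℂ] H :=
  (TensorProduct.lid ℂ H).toLinearMap ∘ₗ LinearMap.rTensor H ω ∘ₗ Coalgebra.comul

/-- The functional `ψ_x : y ↦ ψ (x y)`. -/
def QuantumSet.density (X : QuantumSet H) (x : H) : H →ₗ[ℂ] ℂ :=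
  X.ψ ∘ₗ LinearMap.mulLeft ℂ x

/-- The operator `x ⋆ ·` of convolution by `x`, that is, `L_{ψ_{S(x)}}`. -/
def QuantumSet.convolution (X : QuantumSet H) (x : H) : H →ₗ[ℂ] H :=
  leftConv (X.density (HopfAlgebra.antipode ℂ x))

/-- A quantum Cayley graph: the quantum adjacency matrix is `x ↦ P ⋆ x` for an orthogonal
projection `P` in the algebra. -/
def QuantumGraph.IsCayley {X : QuantumSet H} (G : QuantumGraph X) : Prop :=
  ∃ P : H, IsStarProjection P ∧ G.A = X.convolution P

end QuantumGroups

/-! ### The dual of a finite group -/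

section Dual

open scoped ComplexOrder

variable {Γ : Type*} [Group Γ]

/-- The involution of the group algebra: `(∑ c_g g)^* = ∑ conj(c_g) g⁻¹`. -/
instance groupAlgebraStar : Star (MonoidAlgebra ℂ Γ) where
  star x := .ofCoeff ((x.coeff.mapRange star (star_zero ℂ)).equivMapDomain (Equiv.inv Γ))

theorem groupAlgebra_coeff_star (x : MonoidAlgebra ℂ Γ) (g : Γ) :
    (star x).coeff g = star (x.coeff g⁻¹) := rfl

theorem groupAlgebra_star_single (g : Γ) (c : ℂ) :
    star (MonoidAlgebra.single g c) = MonoidAlgebra.single g⁻¹ (star c) := by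
  classical
  ext h
  rw [groupAlgebra_coeff_star, MonoidAlgebra.coeff_single, MonoidAlgebra.coeff_single,
    Finsupp.single_apply, Finsupp.single_apply]
  by_cases hg : g = h⁻¹
  · simp [hg]
  · have hg' : ¬ g⁻¹ = h := fun e => hg (by rw [← e, inv_inv])
    simp [hg, hg']

theorem groupAlgebra_star_add (x y : MonoidAlgebra ℂ Γ) : star (x + y) = star x + star y := by
  ext g
  simp [groupAlgebra_coeff_star]

theorem groupAlgebra_star_zero : star (0 : MonoidAlgebra ℂ Γ) = 0 := by
  ext g
  simp [groupAlgebra_coeff_star]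

instance groupAlgebraStarRing : StarRing (MonoidAlgebra ℂ Γ) where
  star_involutive x := by
    ext g
    simp [groupAlgebra_coeff_star]
  star_add := groupAlgebra_star_add
  star_mul x y := by
    induction x using MonoidAlgebra.induction_linear with
    | zero => simp [groupAlgebra_star_zero]
    | add x x' hx hx' => rw [add_mul, groupAlgebra_star_add, hx, hx', groupAlgebra_star_add, mul_add]
    | single g c =>
      induction y using MonoidAlgebra.induction_linear with
      | zero => simp [groupAlgebra_star_zero]
      | add y y' hy hy' =>
        rw [mul_add, groupAlgebra_star_add, hy, hy', groupAlgebra_star_add, add_mul]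
      | single h d =>
        simp [groupAlgebra_star_single, MonoidAlgebra.single_mul_single, mul_comm]

instance groupAlgebraStarModule : StarModule ℂ (MonoidAlgebra ℂ Γ) where
  star_smul c x := by
    ext g
    simp [groupAlgebra_coeff_star]

/-- The group algebra `ℂ[Γ]`, with Mathlib's Hopf algebra structure (`Δ g = g ⊗ g`, `ε g = 1`,
`S g = g⁻¹`), is the algebra of a compact quantum group, the dual of `Γ`. -/
instance groupAlgebra_isCompactQuantumGroup : IsCompactQuantumGroup (MonoidAlgebra ℂ Γ) where
  comul_star x := by
    induction x using MonoidAlgebra.induction_linear with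
    | zero => simp
    | add x y hx hy => simp only [star_add, map_add, hx, hy]
    | single g c => simp [groupAlgebra_star_single]
  counit_star x := by
    induction x using MonoidAlgebra.induction_linear with
    | zero => simp
    | add x y hx hy => simp only [star_add, map_add, hx, hy]
    | single g c => simp [groupAlgebra_star_single]
  span_coeff := by
    rw [eq_top_iff, ← (MonoidAlgebra.basis Γ ℂ).span_eq, Submodule.span_le]
    rintro _ ⟨g, rfl⟩
    refine Submodule.subset_span ⟨1, Matrix.of fun _ _ => MonoidAlgebra.single g 1, ⟨?_, ?_⟩, 0, 0, ?_⟩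
    · intro i j
      simp
    · rw [Unitary.mem_iff]
      constructor <;>
      · ext i j : 2
        rw [Subsingleton.elim j i, Matrix.one_apply_eq, MonoidAlgebra.one_def]
        simp [Matrix.mul_apply, Matrix.star_apply, groupAlgebra_star_single,
          MonoidAlgebra.single_mul_single]
    · simp [MonoidAlgebra.basis_apply]

/-- The Haar functional `∑ c_g g ↦ |Γ| c_1` of the dual of a finite group `Γ`, normalised to be
a `1`-form. -/
def dualHaar (Γ : Type*) [Group Γ] [Fintype Γ] : MonoidAlgebra ℂ Γ →ₗ[ℂ] ℂ :=
  (Fintype.card Γ : ℂ) • (MonoidAlgebra.basis Γ ℂ).coord 1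

/-- The map `g ↦ |Γ|⁻¹ ∑ h, h ⊗ h⁻¹ g`. -/
def dualMulAdj (Γ : Type*) [Group Γ] [Fintype Γ] :
    MonoidAlgebra ℂ Γ →ₗ[ℂ] MonoidAlgebra ℂ Γ ⊗[ℂ] MonoidAlgebra ℂ Γ :=
  (MonoidAlgebra.basis Γ ℂ).constr ℂ fun g => (Fintype.card Γ : ℂ)⁻¹ • ∑ h : Γ,
    MonoidAlgebra.single h (1 : ℂ) ⊗ₜ[ℂ] MonoidAlgebra.single (h⁻¹ * g) (1 : ℂ)

variable [Fintype Γ]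

theorem dualHaar_apply (x : MonoidAlgebra ℂ Γ) :
    dualHaar Γ x = (Fintype.card Γ : ℂ) * x.coeff 1 := rfl

theorem dualHaar_single [DecidableEq Γ] (g : Γ) (c : ℂ) :
    dualHaar Γ (MonoidAlgebra.single g c) = if g = 1 then (Fintype.card Γ : ℂ) * c else 0 := by
  rw [dualHaar_apply, MonoidAlgebra.coeff_single, Finsupp.single_apply, mul_ite, mul_zero]

theorem dualMulAdj_single (g : Γ) (c : ℂ) :
    dualMulAdj Γ (MonoidAlgebra.single g c) = c • (Fintype.card Γ : ℂ)⁻¹ • ∑ h : Γ,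
      MonoidAlgebra.single h (1 : ℂ) ⊗ₜ[ℂ] MonoidAlgebra.single (h⁻¹ * g) (1 : ℂ) := by
  have h : MonoidAlgebra.single g c = c • MonoidAlgebra.basis Γ ℂ g := by
    simp [MonoidAlgebra.basis_apply]
  rw [h, map_smul, dualMulAdj, Module.Basis.constr_basis]

theorem dualHaar_pos (x : MonoidAlgebra ℂ Γ) (hx : x ≠ 0) : 0 < dualHaar Γ (star x * x) := by
  classical
  have h1 : (star x * x).coeff 1 = ((∑ g : Γ, ‖x.coeff g‖ ^ 2 : ℝ) : ℂ) := by
    rw [MonoidAlgebra.coeff_mul_apply_right, Finsupp.sum_fintype _ _ (by simp)]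
    simp [groupAlgebra_coeff_star, Complex.conj_mul']
  have h2 : 0 < ∑ g : Γ, ‖x.coeff g‖ ^ 2 := by
    refine Finset.sum_pos' (fun g _ => by positivity) ?_
    by_contra! hc
    apply hx
    ext g
    have := hc g (Finset.mem_univ g)
    simpa using this
  rw [dualHaar_apply, h1]
  have h3 : (0 : ℝ) < Fintype.card Γ := by exact_mod_cast Fintype.card_pos
  exact_mod_cast mul_pos h3 h2

/-- The dual of a finite group `Γ` as a quantum set: the algebra `ℂ[Γ]` with the normalised Haar
functional. -/
def dualQuantumSet (Γ : Type*) [Group Γ] [Fintype Γ] : QuantumSet (MonoidAlgebra ℂ Γ) where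
  finiteDimensional := Module.Finite.of_basis (MonoidAlgebra.basis Γ ℂ)
  ψ := dualHaar Γ
  tracial x y := by
    classical
    induction x using MonoidAlgebra.induction_linear with
    | zero => simp
    | add x x' hx hx' => simp only [add_mul, mul_add, map_add, hx, hx']
    | single g c =>
      induction y using MonoidAlgebra.induction_linear with
      | zero => simp
      | add y y' hy hy' => simp only [add_mul, mul_add, map_add, hy, hy']
      | single h d =>
        simp only [MonoidAlgebra.single_mul_single, dualHaar_single, mul_comm d c,
          mul_eq_one_iff_eq_inv, eq_comm (a := h), inv_eq_iff_eq_inv]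
  pos := dualHaar_pos
  mulAdj := dualMulAdj Γ
  mulAdj_adjoint x y z := by
    classical
    induction z using MonoidAlgebra.induction_linear with
    | zero => simp
    | add z z' hz hz' => simp only [mul_add, map_add, hz, hz']
    | single k c =>
    induction x using MonoidAlgebra.induction_linear with
    | zero => simp
    | add x x' hx hx' =>
      simp only [TensorProduct.add_tmul, star_add, add_mul, map_add, hx, hx']
    | single g a =>
    induction y using MonoidAlgebra.induction_linear with
    | zero => simp
    | add y y' hy hy' =>
      simp only [TensorProduct.tmul_add, star_add, add_mul, mul_add, map_add, hy, hy']
    | single h b =>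
    have hcard : (Fintype.card Γ : ℂ) ≠ 0 := by exact_mod_cast Fintype.card_ne_zero
    simp only [dualMulAdj_single, TensorProduct.star_tmul, groupAlgebra_star_single,
      Algebra.mul_smul_comm, Finset.mul_sum, Algebra.TensorProduct.tmul_mul_tmul, map_smul,
      map_sum, TensorProduct.map_tmul, LinearMap.mul'_apply, MonoidAlgebra.single_mul_single,
      dualHaar_single, mul_one]
    rw [Finset.sum_eq_single g]
    · simp only [inv_mul_cancel, if_true, mul_inv_rev, mul_assoc]
      split_ifs
      · simp [smul_eq_mul]
        field_simp
      · simp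
    · intro l _ hl
      rw [if_neg, zero_mul]
      intro e
      exact hl (inv_mul_eq_one.mp e).symm
    · simp
  mul_mulAdj z := by
    induction z using MonoidAlgebra.induction_linear with
    | zero => simp
    | add z z' hz hz' => simp only [map_add, hz, hz']
    | single k c =>
      have hcard : (Fintype.card Γ : ℂ) ≠ 0 := by exact_mod_cast Fintype.card_ne_zero
      simp [dualMulAdj_single, MonoidAlgebra.single_mul_single, hcard]

end Dual

end

/-!
In terms of the basis `Γ`, convolution by a projection `p` is the Fourier multiplier
`g ↦ |Γ| p(g) g`. Suppose the coefficients of `p` at noncentral elements differ from all its other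
coefficients. Then the line `ℂ g` is an eigenspace for each noncentral `g`, so a homomorphism
`ℂ[Γ] → ℂ[Γ] ⊗ K` commuting with the multiplier maps `g` to `g ⊗ f(g)`. The noncentral elements
generate a perfect group, so this holds for all `g` and `f` is a homomorphism: for `K = ℂ` it is
trivial by perfectness, and for an action of a quantum group it takes group-like values and is the
required Hopf `*`-algebra morphism.

Such a projection exists because a linear functional `χ = ψ(· z)` with `z` noncentral vanishes
only on a thin set of projections. Some projection `p` is noncentral in every noncommutative block.
Rotating `p` by the unitaries `1 - r + w r`, with `r` a projection and `|w| = 1`, makes `χ` a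
polynomial in `w` up to the factor `w`. If one more functional of this kind vanished wherever
finitely many others do not, it would kill all double commutators `[b, [c, p]]`, which forces `z`
to be central.
-/

/-! ### Projections in finite quantum sets -/

section ProperInvolution

theorem isStarProjection_of_star_eq_star_mul_self {B : Type*} [Ring B] [StarRing B] {v : B}
    (h : star v = star v * v) : IsStarProjection v := by
  have hv : star v = v := by
    have h' := congrArg star h
    rw [star_mul, star_star, ← h] at h'
    exact h'.symm
  exact ⟨(hv ▸ h).symm, hv⟩

theorem isStarNormal_sub_algebraMap {B : Type*} [Ring B] [StarRing B] [Algebra ℂ B]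
    [StarModule ℂ B] {x : B} (hx : IsStarNormal x) (a : ℂ) :
    IsStarNormal (x - algebraMap ℂ B a) := by
  refine ⟨?_⟩
  rw [star_sub, ← algebraMap_star_comm]
  exact (hx.star_comm_self.sub_right (Algebra.commutes a _).symm).sub_left
    (Algebra.commutes (star a) _)

/-- The involution of `B` is proper: `x^* x = 0` only for `x = 0`. Finite-dimensional complex
`*`-algebras with this property are the finite-dimensional C*-algebras, without a norm. -/
def HasProperInvolution (B : Type*) [Ring B] [StarRing B] : Prop :=
  ∀ x : B, star x * x = 0 → x = 0

namespace HasProperInvolution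

section Ring

variable {B : Type*} [Ring B] [StarRing B]

theorem mul_eq_zero_of_star_mul_mul_eq_zero (hB : HasProperInvolution B) {n y : B}
    (h : star n * (n * y) = 0) : n * y = 0 := by
  refine hB _ ?_
  rw [star_mul, mul_assoc, h, mul_zero]

theorem star_mul_eq_zero_of_mul_eq_zero (hB : HasProperInvolution B) {n y : B}
    (hn : IsStarNormal n) (h : n * y = 0) : star n * y = 0 := by
  refine hB.mul_eq_zero_of_star_mul_mul_eq_zero ?_
  rw [star_star, ← mul_assoc, ← hn.star_comm_self.eq, mul_assoc, h, mul_zero]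

theorem mul_eq_zero_of_pow_mul_eq_zero (hB : HasProperInvolution B) {n y : B} (hn : IsStarNormal n)
    {k : ℕ} (h : n ^ k * y = 0) : n * y = 0 := by
  induction k with
  | zero => rw [← one_mul y, ← pow_zero n, h, mul_zero]
  | succ k ih =>
    cases k with
    | zero => rwa [zero_add, pow_one] at h
    | succ k =>
      rw [pow_succ', pow_succ', mul_assoc, mul_assoc] at h
      refine ih ?_
      rw [pow_succ', mul_assoc]
      exact hB.mul_eq_zero_of_star_mul_mul_eq_zero (hB.star_mul_eq_zero_of_mul_eq_zero hn h)

theorem isStarProjection_of_isIdempotentElem (hB : HasProperInvolution B) {e : B}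
    (he : IsIdempotentElem e) (hn : IsStarNormal e) : IsStarProjection e := by
  have h : star e * (1 - e) = 0 :=
    hB.star_mul_eq_zero_of_mul_eq_zero hn (by rw [mul_sub, mul_one, he.eq, sub_self])
  rw [mul_sub, mul_one, sub_eq_zero] at h
  exact isStarProjection_of_star_eq_star_mul_self h

end Ring

variable {B : Type*} [Ring B] [StarRing B] [Algebra ℂ B] [StarModule ℂ B]

theorem exists_sum_eigenvectors (hB : HasProperInvolution B) [FiniteDimensional ℂ B]
    {x : B} (hx : IsStarNormal x) :
    ∃ v : ℂ →₀ B, (∀ a, x * v a = a • v a) ∧ (v.sum fun _ y => y) = 1 := by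
  have hone : (1 : B) ∈ ⨆ a, Module.End.maxGenEigenspace (LinearMap.mulLeft ℂ x) a := by
    rw [Module.End.iSup_maxGenEigenspace_eq_top]
    exact Submodule.mem_top
  obtain ⟨v, hv, hsum⟩ := (Submodule.mem_iSup_iff_exists_finsupp _ _).mp hone
  refine ⟨v, fun a => ?_, hsum⟩
  obtain ⟨k, hk⟩ := (Module.End.mem_maxGenEigenspace _ _ _).mp (hv a)
  have hsub : LinearMap.mulLeft ℂ x - a • 1 = LinearMap.mulLeft ℂ (x - algebraMap ℂ B a) := by
    ext y
    simp [sub_mul, Algebra.smul_def]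
  rw [hsub, LinearMap.pow_mulLeft, LinearMap.mulLeft_apply] at hk
  have hzero := hB.mul_eq_zero_of_pow_mul_eq_zero (isStarNormal_sub_algebraMap hx a) hk
  rwa [sub_mul, sub_eq_zero, ← Algebra.smul_def] at hzero

theorem star_mul_eq_zero_of_ne (hB : HasProperInvolution B) {x v w : B} (hx : IsStarNormal x)
    {a b : ℂ} (hab : a ≠ b) (hv : x * v = a • v) (hw : x * w = b • w) : star w * v = 0 := by
  have hstar : star (x - algebraMap ℂ B b) * w = 0 :=
    hB.star_mul_eq_zero_of_mul_eq_zero (isStarNormal_sub_algebraMap hx b)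
      (by rw [sub_mul, hw, Algebra.smul_def, sub_self])
  have hleft : star w * (x - algebraMap ℂ B b) = 0 := by
    simpa using congrArg star hstar
  have hsmul : (a - b) • (star w * v) = 0 := by
    rw [← mul_smul_comm, sub_smul, ← hv, Algebra.smul_def, ← sub_mul, ← mul_assoc, hleft, zero_mul]
  exact (smul_eq_zero.mp hsmul).resolve_left (sub_ne_zero.mpr hab)

theorem mem_span_isStarProjection (hB : HasProperInvolution B) [FiniteDimensional ℂ B]
    {x : B} (hx : IsStarNormal x) : x ∈ Submodule.span ℂ {p : B | IsStarProjection p} := by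
  obtain ⟨v, hv, hsum⟩ := hB.exists_sum_eigenvectors hx
  have hproj : ∀ b, IsStarProjection (v b) := fun b => by
    refine isStarProjection_of_star_eq_star_mul_self ?_
    conv_lhs => rw [← mul_one (star (v b)), ← hsum, Finsupp.sum, Finset.mul_sum]
    refine Finset.sum_eq_single b
      (fun a _ hab => hB.star_mul_eq_zero_of_ne hx hab (hv a) (hv b)) fun hb => ?_
    rw [Finsupp.notMem_support_iff.mp hb, mul_zero]
  rw [← mul_one x, ← hsum, Finsupp.sum, Finset.mul_sum]
  refine Submodule.sum_mem _ fun a _ => ?_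
  rw [hv]
  exact Submodule.smul_mem _ _ (Submodule.subset_span (hproj a))

theorem span_isStarProjection (hB : HasProperInvolution B) [FiniteDimensional ℂ B] :
    Submodule.span ℂ {p : B | IsStarProjection p} = ⊤ := by
  rw [eq_top_iff, ← span_selfAdjoint, Submodule.span_le]
  exact fun x hx => hB.mem_span_isStarProjection (IsSelfAdjoint.isStarNormal hx)

end HasProperInvolution

end ProperInvolution

namespace QuantumSet

variable {B : Type*} [Ring B] [StarRing B] [Algebra ℂ B] [StarModule ℂ B]

open scoped ComplexOrder in
theorem eq_zero_of_ψ_star_mul_self (X : QuantumSet B) {x : B} (h : X.ψ (star x * x) = 0) :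
    x = 0 := by
  by_contra hx
  exact (X.pos x hx).ne' h

theorem eq_zero_of_forall_ψ_mul (X : QuantumSet B) {x : B} (h : ∀ y, X.ψ (y * x) = 0) : x = 0 :=
  X.eq_zero_of_ψ_star_mul_self (h (star x))

theorem hasProperInvolution (X : QuantumSet B) : HasProperInvolution B := fun x hx =>
  X.eq_zero_of_ψ_star_mul_self (by rw [hx, map_zero])

theorem span_isStarProjection (X : QuantumSet B) :
    Submodule.span ℂ {p : B | IsStarProjection p} = ⊤ :=
  have := X.finiteDimensional
  X.hasProperInvolution.span_isStarProjection

theorem exists_add_eq_one_of_isTwoSided (X : QuantumSet B) (I : Ideal B) [I.IsTwoSided] :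
    ∃ e f : B, e ∈ I ∧ e + f = 1 ∧ ∀ x ∈ I, X.ψ (f * x) = 0 := by
  have := X.finiteDimensional
  let Φ : LinearMap.BilinForm ℂ B := (LinearMap.mul ℂ B).compr₂ X.ψ
  have hΦ : Φ.IsRefl := fun x y h => (X.tracial y x).trans h
  have hdisj : Disjoint (I.restrictScalars ℂ) (Φ.orthogonal (I.restrictScalars ℂ)) := by
    rw [Submodule.disjoint_def]
    intro x hx hort
    have hxx : star x * x ∈ I := I.mul_mem_left _ hx
    have hpow : X.ψ (star x * x * star x * x) = 0 := hort _ (I.mul_mem_right _ hxx)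
    have hzero : star x * x = 0 := X.eq_zero_of_ψ_star_mul_self (by
      rwa [star_mul, star_star, ← mul_assoc])
    exact X.hasProperInvolution x hzero
  obtain ⟨e, he, f, hf, hef⟩ := Submodule.mem_sup.mp
    (((LinearMap.BilinForm.isCompl_orthogonal_iff_disjoint hΦ).mpr hdisj).sup_eq_top ▸
      Submodule.mem_top (x := (1 : B)))
  exact ⟨e, f, he, hef, fun x hx => hΦ _ _ (hf x hx)⟩

theorem exists_central_projection (X : QuantumSet B) (I : Ideal B) [I.IsTwoSided] :
    ∃ e ∈ I, IsStarProjection e ∧ (∀ b, Commute e b) ∧ ∀ x ∈ I, e * x = x := by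
  obtain ⟨e, f, he, hef, hf⟩ := X.exists_add_eq_one_of_isTwoSided I
  have hfx : ∀ x ∈ I, f * x = 0 := fun x hx => by
    refine X.eq_zero_of_ψ_star_mul_self ?_
    rw [X.tracial, mul_assoc]
    exact hf _ (I.mul_mem_right _ hx)
  have hxf : ∀ x ∈ I, x * f = 0 := fun x hx => by
    refine X.eq_zero_of_ψ_star_mul_self ?_
    rw [star_mul, ← mul_assoc, X.tracial]
    exact hf _ (I.mul_mem_left _ hx)
  have hex : ∀ x ∈ I, e * x = x := fun x hx => by
    rw [← add_zero (e * x), ← hfx x hx, ← add_mul, hef, one_mul]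
  have hxe : ∀ x ∈ I, x * e = x := fun x hx => by
    rw [← add_zero (x * e), ← hxf x hx, ← mul_add, hef, mul_one]
  have hcomm : ∀ b, Commute e b := fun b => by
    rw [Commute, SemiconjBy, ← hxe _ (I.mul_mem_right b he), mul_assoc,
      hex _ (I.mul_mem_left b he)]
  exact ⟨e, he, X.hasProperInvolution.isStarProjection_of_isIdempotentElem (hex e he)
    ⟨(hcomm _).symm⟩, hcomm, hex⟩

end QuantumSet

section Commutators

theorem lie_lie_lie_of_isIdempotentElem {B : Type*} [Ring B] {p : B} (hp : IsIdempotentElem p)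
    (b : B) : ⁅⁅⁅b, p⁆, p⁆, p⁆ = ⁅b, p⁆ := by
  simp only [Ring.lie_def, sub_mul, mul_sub, mul_assoc, hp.eq, ← mul_assoc p p]
  abel

variable {B : Type*} [Ring B] {p z : B}

theorem lie_mul_lie_add_lie_mul_lie (hz : ∀ b : B, Commute z ⁅b, p⁆) (x y : B) :
    ⁅z, x⁆ * ⁅y, p⁆ + ⁅x, p⁆ * ⁅z, y⁆ = 0 := by
  have hz' : ∀ b : B, ⁅z, ⁅b, p⁆⁆ = 0 := fun b => commute_iff_lie_eq.mp (hz b)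
  calc ⁅z, x⁆ * ⁅y, p⁆ + ⁅x, p⁆ * ⁅z, y⁆
      = ⁅z, ⁅x * y, p⁆⁆ - ⁅z, ⁅x, p⁆⁆ * y - x * ⁅z, ⁅y, p⁆⁆ := by
        simp only [Ring.lie_def]
        noncomm_ring
    _ = 0 := by rw [hz', hz', hz', zero_mul, mul_zero, sub_zero, sub_zero]

theorem lie_mul_mul_lie_add_lie_mul_mul_lie (hz : ∀ b : B, Commute z ⁅b, p⁆) (x y w : B) :
    ⁅z, x⁆ * y * ⁅w, p⁆ + ⁅x, p⁆ * y * ⁅z, w⁆ = 0 := by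
  calc ⁅z, x⁆ * y * ⁅w, p⁆ + ⁅x, p⁆ * y * ⁅z, w⁆
      = (⁅z, x⁆ * ⁅y * w, p⁆ + ⁅x, p⁆ * ⁅z, y * w⁆)
          - (⁅z, x⁆ * ⁅y, p⁆ + ⁅x, p⁆ * ⁅z, y⁆) * w := by
        simp only [Ring.lie_def]
        noncomm_ring
    _ = 0 := by
        rw [lie_mul_lie_add_lie_mul_lie hz, lie_mul_lie_add_lie_mul_lie hz, zero_mul, sub_zero]

theorem lie_mul_mul_lie_eq_zero (hp : IsIdempotentElem p) (hz : ∀ b : B, Commute z ⁅b, p⁆)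
    (x y w : B) : ⁅z, x⁆ * y * ⁅w, p⁆ = 0 := by
  have h := lie_mul_mul_lie_add_lie_mul_mul_lie hz x y ⁅⁅w, p⁆, p⁆
  rwa [lie_lie_lie_of_isIdempotentElem hp, commute_iff_lie_eq.mp (hz _), mul_zero, add_zero] at h

/-- The annihilator `{a | a B [B, p] = 0}` of the two-sided ideal generated by the commutators
with `p`. -/
def commutatorAnnihilator (p : B) : Ideal B :=
  (Ideal.span (Set.range fun b : B => ⁅b, p⁆)).annihilator

instance (p : B) : (commutatorAnnihilator p).IsTwoSided := by
  unfold commutatorAnnihilator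
  infer_instance

theorem mem_commutatorAnnihilator {a : B} :
    a ∈ commutatorAnnihilator p ↔ ∀ b c : B, a * b * ⁅c, p⁆ = 0 := by
  rw [commutatorAnnihilator, Submodule.mem_annihilator]
  refine ⟨fun h b c => ?_, fun h x hx => ?_⟩
  · rw [mul_assoc]
    exact h _ (Ideal.mul_mem_left _ b (Ideal.subset_span ⟨c, rfl⟩))
  · suffices H : ∀ b, a * (b * x) = 0 by simpa using H 1
    induction hx using Submodule.span_induction with
    | mem x hx =>
      obtain ⟨c, rfl⟩ := hx
      exact fun b => by rw [← mul_assoc]; exact h b c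
    | zero => simp
    | add x y _ _ hx hy => exact fun b => by rw [mul_add, mul_add, hx, hy, add_zero]
    | smul r x _ hx => exact fun b => by rw [smul_eq_mul, ← mul_assoc b, hx]

end Commutators

/-! ### Generic projections -/

section EverywhereNoncentral

/-- Only central elements commute with all commutators of `p`. In terms of the Wedderburn
decomposition of a semisimple algebra `B`, the component of an idempotent `p` in every
noncommutative simple block is noncentral. -/
def IsEverywhereNoncentral {B : Type*} [Ring B] (p : B) : Prop :=
  Set.centralizer (Set.range fun b : B => ⁅b, p⁆) ⊆ Set.center B

theorem IsEverywhereNoncentral.map {B C : Type*} [Ring B] [Ring C] {p : B}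
    (hp : IsEverywhereNoncentral p) (f : B ≃+* C) : IsEverywhereNoncentral (f p) := by
  intro z hz
  rw [Semigroup.mem_center_iff]
  intro c
  obtain ⟨z, rfl⟩ := f.surjective z
  obtain ⟨c, rfl⟩ := f.surjective c
  have h : z ∈ Set.center B := hp <| by
    rintro _ ⟨b, rfl⟩
    refine f.injective ?_
    simpa [Ring.lie_def] using hz ⁅f b, f p⁆ ⟨f b, rfl⟩
  rw [← map_mul, ← map_mul, Semigroup.mem_center_iff.mp h]

variable {B : Type*} [Ring B]

theorem isStarProjection_one_sub_mul_add_mul [StarRing B] {e p q : B} (he : IsStarProjection e)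
    (hcomm : ∀ b, Commute e b) (hp : IsStarProjection p) (hq : IsStarProjection q) :
    IsStarProjection ((1 - e) * p + e * q) := by
  have hcomm' : ∀ b, Commute (1 - e) b := fun b => (Commute.one_left b).sub_left (hcomm b)
  refine (he.one_sub.mul hp (hcomm' p)).add (he.mul hq (hcomm q)) ?_
  rw [mul_assoc, ← mul_assoc p, ← (hcomm p).eq, mul_assoc e p, ← mul_assoc (1 - e),
    he.one_sub_mul_self, zero_mul]

theorem lie_one_sub_mul_add_mul {e : B} (hcomm : ∀ b, Commute e b) (b p q : B) :
    ⁅b, (1 - e) * p + e * q⁆ = (1 - e) * ⁅b, p⁆ + e * ⁅b, q⁆ := by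
  have h : b * e = e * b := (hcomm b).symm.eq
  simp only [Ring.lie_def, mul_add, add_mul, mul_sub, sub_mul, one_mul, ← mul_assoc, h]
  abel

theorem mul_lie_eq_zero_of_minimalFor [StarRing B] {e p q : B}
    (hp : MinimalFor IsStarProjection commutatorAnnihilator p) (he : IsStarProjection e)
    (hcomm : ∀ b, Commute e b) (hep : e ∈ commutatorAnnihilator p) (hq : IsStarProjection q)
    (c : B) : e * ⁅c, q⁆ = 0 := by
  set r := (1 - e) * p + e * q with hr
  have hlie : ∀ c : B, (1 - e) * ⁅c, r⁆ = ⁅c, p⁆ := fun c => by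
    have h : e * ⁅c, p⁆ = 0 := by simpa using mem_commutatorAnnihilator.mp hep 1 c
    rw [hr, lie_one_sub_mul_add_mul hcomm, mul_add, ← mul_assoc, he.one_sub.isIdempotentElem.eq,
      ← mul_assoc, he.one_sub_mul_self, zero_mul, add_zero, sub_mul, one_mul, h, sub_zero]
  have hle : commutatorAnnihilator r ≤ commutatorAnnihilator p := fun a ha => by
    refine mem_commutatorAnnihilator.mpr fun b c => ?_
    rw [← hlie, ← mul_assoc, mul_assoc a]
    exact mem_commutatorAnnihilator.mp ha _ c
  have her : e ∈ commutatorAnnihilator r :=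
    hp.2 (isStarProjection_one_sub_mul_add_mul he hcomm hp.1 hq) hle hep
  have h := mem_commutatorAnnihilator.mp her 1 c
  rwa [mul_one, hr, lie_one_sub_mul_add_mul hcomm, mul_add, ← mul_assoc, he.mul_one_sub_self,
    zero_mul, zero_add, ← mul_assoc, he.isIdempotentElem.eq] at h

-- Let `p` have a minimal commutator annihilator, with unit `e`. Any projection `q` can replace `p`
-- on the summand `e B`, so by minimality `q` is central there; and `[z, q]` lies in `e B` when `z`
-- commutes with all `[b, p]`.
theorem QuantumSet.exists_isEverywhereNoncentral [StarRing B] [Algebra ℂ B] [StarModule ℂ B]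
    (X : QuantumSet B) : ∃ p : B, IsStarProjection p ∧ IsEverywhereNoncentral p := by
  have := X.finiteDimensional
  have : IsArtinianRing B := IsArtinianRing.of_finite ℂ B
  obtain ⟨p, hp⟩ := exists_minimalFor_of_wellFoundedLT IsStarProjection
    (commutatorAnnihilator (B := B)) ⟨0, IsStarProjection.zero B⟩
  obtain ⟨e, hep, he, hcomm, hunit⟩ := X.exists_central_projection (commutatorAnnihilator p)
  refine ⟨p, hp.1, fun z hz => ?_⟩
  have hzp : ∀ b : B, Commute z ⁅b, p⁆ := fun b => (hz _ ⟨b, rfl⟩).symm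
  have hzq : ∀ q, IsStarProjection q → q ∈ Subalgebra.centralizer ℂ {z} := fun q hq => by
    have h : ⁅z, q⁆ ∈ commutatorAnnihilator p := mem_commutatorAnnihilator.mpr fun b c =>
      lie_mul_mul_lie_eq_zero hp.1.isIdempotentElem hzp q b c
    simp only [Subalgebra.mem_centralizer_iff, Set.mem_singleton_iff, forall_eq]
    rw [← commute_iff_eq, commute_iff_lie_eq, ← hunit _ h,
      mul_lie_eq_zero_of_minimalFor hp he hcomm hep hq]
  have htop : Submodule.span ℂ {q : B | IsStarProjection q} ≤
      (Subalgebra.centralizer ℂ {z}).toSubmodule := Submodule.span_le.mpr hzq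
  rw [X.span_isStarProjection] at htop
  exact Semigroup.mem_center_iff.mpr fun b =>
    (Subalgebra.mem_centralizer_iff ℂ |>.mp (htop (Submodule.mem_top (x := b))) z rfl).symm

end EverywhereNoncentral

section Rotation

theorem infinite_range_circle_coe : (Set.range fun w : Circle => (w : ℂ)).Infinite := by
  have : Infinite (Set.Ioc (-Real.pi) Real.pi) :=
    (Set.Ioc_infinite (neg_lt_self Real.pi_pos)).to_subtype
  have : Infinite Circle := Infinite.of_injective _ Circle.argEquiv.symm.injective
  exact Set.infinite_range_of_injective Circle.coe_injective

variable {B : Type*} [Ring B] [Algebra ℂ B]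

/-- The polynomial with value `w φ(u p u^*)` at phases `w`, where `u = phase r w`. -/
noncomputable def rotationPolynomial (φ : B →ₗ[ℂ] ℂ) (r p : B) : Polynomial ℂ :=
  Polynomial.C (φ (r * p * (1 - r))) * Polynomial.X ^ 2
    + Polynomial.C (φ (r * p * r + (1 - r) * p * (1 - r))) * Polynomial.X
    + Polynomial.C (φ ((1 - r) * p * r))

variable {φ : B →ₗ[ℂ] ℂ} {r p : B}

theorem rotationPolynomial_ne_zero (h : φ p ≠ 0) : rotationPolynomial φ r p ≠ 0 := by
  intro h0
  refine h ?_
  have hp : p = r * p * (1 - r) + (r * p * r + (1 - r) * p * (1 - r)) + (1 - r) * p * r := by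
    noncomm_ring
  have heval := congrArg (Polynomial.eval 1) h0
  rw [hp, map_add, map_add]
  simpa [rotationPolynomial] using heval

theorem map_lie_eq_zero_of_rotationPolynomial_eq_zero (h : rotationPolynomial φ r p = 0) :
    φ ⁅r, p⁆ = 0 := by
  have h2 : φ (r * p * (1 - r)) = 0 := by
    simpa [rotationPolynomial, Polynomial.coeff_X, Polynomial.coeff_C]
      using congrArg (Polynomial.coeff · 2) h
  have h0 : φ ((1 - r) * p * r) = 0 := by
    simpa [rotationPolynomial, Polynomial.coeff_X, Polynomial.coeff_C]
      using congrArg (Polynomial.coeff · 0) h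
  have hlie : ⁅r, p⁆ = r * p * (1 - r) - (1 - r) * p * r := by
    rw [Ring.lie_def]
    noncomm_ring
  rw [hlie, map_sub, h2, h0, sub_zero]

variable [StarRing B] [StarModule ℂ B]

/-- The unitary `1 - r + w r`, for a projection `r` and a phase `w`. -/
def phase {r : B} (hr : IsStarProjection r) (w : Circle) : unitary B :=
  ⟨1 - r + (w : ℂ) • r, by
    have hs : star (1 - r + (w : ℂ) • r) = 1 - r + star (w : ℂ) • r := by
      rw [star_add, star_smul, hr.one_sub.isSelfAdjoint.star_eq, hr.isSelfAdjoint.star_eq]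
    have hw : star (w : ℂ) * w = 1 := by
      rw [Complex.star_def, Complex.conj_mul', Circle.norm_coe]
      norm_num
    have hmul : ∀ a b : ℂ, a * b = 1 → (1 - r + a • r) * (1 - r + b • r) = 1 := fun a b hab => by
      rw [add_mul, mul_add, mul_add, hr.one_sub.isIdempotentElem.eq, mul_smul_comm,
        hr.one_sub_mul_self, smul_mul_assoc, hr.mul_one_sub_self, smul_mul_smul_comm,
        hr.isIdempotentElem.eq, hab]
      simp
    exact Unitary.mem_iff.mpr ⟨hs ▸ hmul _ _ hw, hs ▸ hmul _ _ ((mul_comm _ _).trans hw)⟩⟩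

theorem coe_phase (hr : IsStarProjection r) (w : Circle) :
    (phase hr w : B) = 1 - r + (w : ℂ) • r :=
  rfl

theorem coe_star_phase (hr : IsStarProjection r) (w : Circle) :
    star (phase hr w : B) = 1 - r + star (w : ℂ) • r := by
  rw [coe_phase, star_add, star_smul, hr.one_sub.isSelfAdjoint.star_eq, hr.isSelfAdjoint.star_eq]

theorem eval_rotationPolynomial (φ : B →ₗ[ℂ] ℂ) (hr : IsStarProjection r) (p : B) (w : Circle) :
    (rotationPolynomial φ r p).eval (w : ℂ)
      = w * φ (Unitary.conjStarAlgAut ℂ B (phase hr w) p) := by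
  have hw : (w : ℂ) * star (w : ℂ) = 1 := by
    rw [Complex.star_def, Complex.mul_conj', Circle.norm_coe]
    norm_num
  have hconj : Unitary.conjStarAlgAut ℂ B (phase hr w) p
      = (w : ℂ) • (r * p * (1 - r)) + (r * p * r + (1 - r) * p * (1 - r))
        + star (w : ℂ) • ((1 - r) * p * r) := by
    rw [Unitary.conjStarAlgAut_apply, coe_star_phase, coe_phase]
    simp only [add_mul, mul_add, smul_mul_assoc, mul_smul_comm, smul_add, smul_smul,
      mul_comm (star (w : ℂ)), hw, one_smul]
    abel
  simp only [rotationPolynomial, hconj, Polynomial.eval_add, Polynomial.eval_mul, Polynomial.eval_C,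
    Polynomial.eval_X, Polynomial.eval_pow, map_add, map_smul, smul_eq_mul]
  linear_combination -φ ((1 - r) * p * r) * hw

end Rotation

section Genericity

variable {B : Type*} [Ring B] [StarRing B] [Algebra ℂ B] [StarModule ℂ B]
  {S : Set B} {s : Finset (B →ₗ[ℂ] ℂ)} {φ : B →ₗ[ℂ] ℂ} {p : B}

theorem map_lie_eq_zero_of_isStarProjection
    (hS : ∀ p ∈ S, ∀ u : unitary B, Unitary.conjStarAlgAut ℂ B u p ∈ S)
    (hφ : ∀ q ∈ S, (∀ χ ∈ s, χ q ≠ 0) → φ q = 0) (hp : p ∈ S) (hχ : ∀ χ ∈ s, χ p ≠ 0)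
    {r : B} (hr : IsStarProjection r) : φ ⁅r, p⁆ = 0 := by
  refine map_lie_eq_zero_of_rotationPolynomial_eq_zero ?_
  have hprod : rotationPolynomial φ r p * ∏ χ ∈ s, rotationPolynomial χ r p = 0 := by
    refine Polynomial.eq_zero_of_infinite_isRoot _ (infinite_range_circle_coe.mono ?_)
    rintro _ ⟨w, rfl⟩
    simp only [Set.mem_ofPred_eq, Polynomial.IsRoot, Polynomial.eval_mul, Polynomial.eval_prod,
      eval_rotationPolynomial _ hr]
    by_cases h : ∀ χ ∈ s, χ (Unitary.conjStarAlgAut ℂ B (phase hr w) p) ≠ 0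
    · rw [hφ _ (hS p hp _) h, mul_zero, zero_mul]
    · push Not at h
      obtain ⟨χ, hχs, h0⟩ := h
      rw [Finset.prod_eq_zero hχs (by rw [h0, mul_zero]), mul_zero]
  exact (mul_eq_zero.mp hprod).resolve_right
    (Finset.prod_ne_zero_iff.mpr fun χ hχs => rotationPolynomial_ne_zero (hχ χ hχs))

variable [FiniteDimensional ℂ B]

theorem HasProperInvolution.map_lie_eq_zero (hB : HasProperInvolution B)
    (hS : ∀ p ∈ S, ∀ u : unitary B, Unitary.conjStarAlgAut ℂ B u p ∈ S)
    (hφ : ∀ q ∈ S, (∀ χ ∈ s, χ q ≠ 0) → φ q = 0) (hp : p ∈ S) (hχ : ∀ χ ∈ s, χ p ≠ 0) (b : B) :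
    φ ⁅b, p⁆ = 0 := by
  have hle : Submodule.span ℂ {r : B | IsStarProjection r} ≤
      LinearMap.ker (φ ∘ₗ LinearMap.mulRight ℂ p - φ ∘ₗ LinearMap.mulLeft ℂ p) :=
    Submodule.span_le.mpr fun r hr => by
      simpa [Ring.lie_def] using map_lie_eq_zero_of_isStarProjection hS hφ hp hχ hr
  rw [hB.span_isStarProjection] at hle
  simpa [Ring.lie_def] using hle (Submodule.mem_top (x := b))

theorem HasProperInvolution.exists_mem_forall_ne_zero (hB : HasProperInvolution B)
    (hne : S.Nonempty) (hS : ∀ p ∈ S, ∀ u : unitary B, Unitary.conjStarAlgAut ℂ B u p ∈ S)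
    (hs : ∀ χ ∈ s, ∀ p ∈ S, ∃ b c : B, χ ⁅b, ⁅c, p⁆⁆ ≠ 0) : ∃ p ∈ S, ∀ χ ∈ s, χ p ≠ 0 := by
  classical
  induction s using Finset.induction_on with
  | empty =>
    obtain ⟨p, hp⟩ := hne
    exact ⟨p, hp, by simp⟩
  | insert φ s _ ih =>
    obtain ⟨p, hp, hχ⟩ := ih fun χ hχ => hs χ (Finset.mem_insert_of_mem hχ)
    obtain ⟨b, c, hbc⟩ := hs φ (Finset.mem_insert_self φ s) p hp
    by_contra! hcon
    have hφ : ∀ q ∈ S, (∀ χ ∈ s, χ q ≠ 0) → φ q = 0 := fun q hq hqs => by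
      by_contra hne0
      obtain ⟨χ, hχ, h0⟩ := hcon q hq
      rcases Finset.mem_insert.mp hχ with rfl | hχ
      exacts [hne0 h0, hqs χ hχ h0]
    exact hbc (hB.map_lie_eq_zero
      (φ := φ ∘ₗ (LinearMap.mulLeft ℂ b - LinearMap.mulRight ℂ b)) hS
      (fun q hq hqs => hB.map_lie_eq_zero hS hφ hq hqs b) hp hχ c)

end Genericity

namespace QuantumSet

variable {B : Type*} [Ring B] [StarRing B] [Algebra ℂ B] [StarModule ℂ B]

theorem exists_ψ_lie_lie_mul_ne_zero (X : QuantumSet B) {p z : B} (hp : IsEverywhereNoncentral p)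
    (hz : z ∉ Set.center B) : ∃ b c : B, X.ψ (⁅b, ⁅c, p⁆⁆ * z) ≠ 0 := by
  by_contra! hcon
  refine hz (hp ?_)
  rintro _ ⟨c, rfl⟩
  refine sub_eq_zero.mp (X.eq_zero_of_forall_ψ_mul fun b => ?_)
  rw [← hcon b c, Ring.lie_def b, mul_sub, sub_mul, map_sub, map_sub, mul_assoc b,
    ← mul_assoc b z, X.tracial (b * z), mul_assoc ⁅c, p⁆]

theorem exists_isStarProjection_forall_ψ_mul_ne_zero (X : QuantumSet B) (Z : Finset B)
    (hZ : ∀ z ∈ Z, z ∉ Set.center B) :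
    ∃ p : B, IsStarProjection p ∧ ∀ z ∈ Z, X.ψ (p * z) ≠ 0 := by
  classical
  have := X.finiteDimensional
  let s := Z.image fun z => X.ψ ∘ₗ LinearMap.mulRight ℂ z
  have hs : ∀ χ ∈ s, ∀ p ∈ {p | IsStarProjection p ∧ IsEverywhereNoncentral p},
      ∃ b c : B, χ ⁅b, ⁅c, p⁆⁆ ≠ 0 := fun χ hχ p hp => by
    obtain ⟨z, hz, rfl⟩ := Finset.mem_image.mp hχ
    exact X.exists_ψ_lie_lie_mul_ne_zero hp.2 (hZ z hz)
  obtain ⟨p, hp, h⟩ := X.hasProperInvolution.exists_mem_forall_ne_zero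
    X.exists_isEverywhereNoncentral
    (fun p hp u => ⟨hp.1.map _, hp.2.map (Unitary.conjStarAlgAut ℂ B u).toRingEquiv⟩) hs
  exact ⟨p, hp.1, fun z hz => h _ (Finset.mem_image_of_mem _ hz)⟩

end QuantumSet

/-! ### Cayley graphs on the dual of a finite group -/

section Groups

theorem closure_compl_eq_top_of_ne_top {G : Type*} [Group G] {H : Subgroup G} (hH : H ≠ ⊤) :
    Submonoid.closure (H : Set G)ᶜ = ⊤ := by
  obtain ⟨k, hk⟩ := SetLike.exists_not_mem_of_ne_top H hH
  refine eq_top_iff.mpr fun g _ => ?_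
  by_cases hg : g ∈ H
  · rw [← mul_inv_cancel_right g k]
    exact mul_mem (Submonoid.subset_closure fun h => hk ((H.mul_mem_cancel_left hg).mp h))
      (Submonoid.subset_closure fun h => hk (H.inv_mem_iff.mp h))
  · exact Submonoid.subset_closure hg

theorem closure_compl_center_of_isPerfect {G : Type*} [Group G] (hG : Group.IsPerfect G) :
    Submonoid.closure (Subgroup.center G : Set G)ᶜ = ⊤ := by
  by_cases h : Subgroup.center G = ⊤
  · have : IsMulCommutative G := ⟨⟨fun a b =>
      (Subgroup.mem_center_iff.mp (h ▸ Subgroup.mem_top b) a)⟩⟩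
    have : Subsingleton G := Group.IsPerfect.subsingleton_of_isMulCommutative
    exact Subsingleton.elim _ _
  · exact closure_compl_eq_top_of_ne_top h

theorem map_eq_one_of_isPerfect {G M : Type*} [Group G] [CommMonoid M] (hG : Group.IsPerfect G)
    (f : G →* M) (g : G) : f g = 1 := by
  have h : g ∈ f.toHomUnits.ker :=
    Abelianization.commutator_subset_ker f.toHomUnits (hG.commutator_eq_top ▸ Subgroup.mem_top g)
  exact congrArg Units.val (MonoidHom.mem_ker.mp h)

end Groups

section RegularAction

variable (H : Type*) [Ring H] [StarRing H] [HopfAlgebra ℂ H] [StarModule ℂ H]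
  [IsCompactQuantumGroup H]

theorem QuantumAction.lid_rTensor_counit_regular (x : H) :
    TensorProduct.lid ℂ H (LinearMap.rTensor H (Coalgebra.counit (R := ℂ))
      ((QuantumAction.regular H).hom x)) = x := by
  have h := Coalgebra.rTensor_counit_comul (R := ℂ) x
  exact (congrArg (TensorProduct.lid ℂ H) h).trans (by simp)

theorem QuantumAction.isFaithful_regular : (QuantumAction.regular H).IsFaithful := by
  intro S hS _ _
  refine eq_top_iff.mpr fun x _ => ?_
  rw [← QuantumAction.lid_rTensor_counit_regular H x]
  exact hS _ x

theorem QuantumAction.isErgodic_regular : (QuantumAction.regular H).IsErgodic := by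
  refine Set.Subset.antisymm (fun x hx => ?_) ?_
  · refine ⟨Coalgebra.counit (R := ℂ) x, ?_⟩
    have h := QuantumAction.lid_rTensor_counit_regular H x
    rw [Set.mem_ofPred_eq.mp hx, LinearMap.rTensor_tmul, TensorProduct.lid_tmul] at h
    rw [Algebra.algebraMap_eq_smul_one, h]
  · rintro _ ⟨c, rfl⟩
    refine (AlgHomClass.commutes (QuantumAction.regular H).hom c).trans ?_
    rw [Algebra.TensorProduct.algebraMap_apply]

end RegularAction

section SeparatingProjection

variable {Γ : Type*} [Group Γ]

theorem single_sub_single_notMem_center {R : Type*} [Ring R] [CharZero R] {g h : Γ}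
    (hg : g ∉ Subgroup.center Γ) (hne : h ≠ g) :
    (MonoidAlgebra.single g 1 - MonoidAlgebra.single h 1 : MonoidAlgebra R Γ) ∉ Set.center _ := by
  classical
  intro hc
  rw [Subgroup.mem_center_iff] at hg
  push Not at hg
  obtain ⟨x, hx⟩ := hg
  have hcoeff := congrArg (fun y => MonoidAlgebra.coeff y (g * x))
    (Semigroup.mem_center_iff.mp hc (MonoidAlgebra.single x 1))
  simp only [sub_mul, mul_sub, MonoidAlgebra.single_mul_single, mul_one, MonoidAlgebra.coeff_sub,
    MonoidAlgebra.coeff_single, Finsupp.sub_apply, Finsupp.single_apply, if_true,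
    mul_left_inj, if_neg hne, if_neg hx] at hcoeff
  split_ifs at hcoeff <;> norm_num at hcoeff

/-- The coefficient of `p` at any noncentral `g : Γ` differs from all other coefficients of `p`.
Equivalently, each line `ℂ g` with `g` noncentral is an eigenspace of the convolution by `p`. -/
def SeparatesNoncentral (p : MonoidAlgebra ℂ Γ) : Prop :=
  ∀ g ∉ Subgroup.center Γ, ∀ h ≠ g, p.coeff h ≠ p.coeff g

theorem dualHaar_mul_single [Fintype Γ] (p : MonoidAlgebra ℂ Γ) (g : Γ) :
    dualHaar Γ (p * MonoidAlgebra.single g⁻¹ 1) = Fintype.card Γ * p.coeff g := by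
  rw [dualHaar_apply, MonoidAlgebra.coeff_mul_single_apply]
  simp

theorem exists_isStarProjection_separatesNoncentral (Γ : Type*) [Group Γ] [Finite Γ] :
    ∃ p : MonoidAlgebra ℂ Γ, IsStarProjection p ∧ SeparatesNoncentral p := by
  classical
  have := Fintype.ofFinite Γ
  let Z : Finset (MonoidAlgebra ℂ Γ) :=
    (Finset.univ.filter fun t : Γ × Γ => t.1 ∉ Subgroup.center Γ ∧ t.2 ≠ t.1).image
      fun t => MonoidAlgebra.single t.1⁻¹ 1 - MonoidAlgebra.single t.2⁻¹ 1
  have hZ : ∀ z ∈ Z, z ∉ Set.center (MonoidAlgebra ℂ Γ) := fun z hz => by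
    obtain ⟨⟨g, h⟩, ht, rfl⟩ := Finset.mem_image.mp hz
    obtain ⟨-, hg, hne⟩ := Finset.mem_filter.mp ht
    exact single_sub_single_notMem_center (mt inv_mem_iff.mp hg) (inv_injective.ne hne)
  obtain ⟨p, hp, h⟩ := (dualQuantumSet Γ).exists_isStarProjection_forall_ψ_mul_ne_zero Z hZ
  refine ⟨p, hp, fun g hg k hne heq => h _ (Finset.mem_image.mpr
    ⟨(g, k), Finset.mem_filter.mpr ⟨Finset.mem_univ _, hg, hne⟩, rfl⟩) ?_⟩
  change dualHaar Γ _ = 0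
  rw [mul_sub, map_sub, dualHaar_mul_single, dualHaar_mul_single, heq, sub_self]

end SeparatingProjection

section CayleyGraph

variable {Γ : Type*} [Group Γ] [Fintype Γ] {p : MonoidAlgebra ℂ Γ}

theorem dualHaar_antipode_mul_single (p : MonoidAlgebra ℂ Γ) (g : Γ) :
    dualHaar Γ (HopfAlgebra.antipode ℂ p * MonoidAlgebra.single g 1)
      = Fintype.card Γ * p.coeff g := by
  classical
  induction p using MonoidAlgebra.induction_linear with
  | zero => simp
  | add x y hx hy => simp [add_mul, mul_add, hx, hy]
  | single h c =>
    simp [MonoidAlgebra.antipode_single, MonoidAlgebra.single_mul_single, dualHaar_single,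
      Finsupp.single_apply, inv_mul_eq_one]

theorem convolution_single (p : MonoidAlgebra ℂ Γ) (g : Γ) (c : ℂ) :
    (dualQuantumSet Γ).convolution p (MonoidAlgebra.single g c)
      = (Fintype.card Γ * p.coeff g) • MonoidAlgebra.single g c := by
  have h : MonoidAlgebra.single g c = c • MonoidAlgebra.single g (1 : ℂ) := by simp
  rw [h, map_smul, smul_comm]
  congr 1
  rw [← dualHaar_antipode_mul_single]
  simp [QuantumSet.convolution, leftConv, QuantumSet.density, dualQuantumSet]

theorem schur_convolution (p q : MonoidAlgebra ℂ Γ) :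
    (dualQuantumSet Γ).schur ((dualQuantumSet Γ).convolution p) ((dualQuantumSet Γ).convolution q)
      = (dualQuantumSet Γ).convolution (p * q) := by
  classical
  have hcard : (Fintype.card Γ : ℂ) ≠ 0 := Nat.cast_ne_zero.mpr Fintype.card_ne_zero
  refine (MonoidAlgebra.basis Γ ℂ).ext fun g => ?_
  rw [MonoidAlgebra.basis_apply]
  change LinearMap.mul' ℂ _ (TensorProduct.map _ _ (dualMulAdj Γ (MonoidAlgebra.single g 1))) = _
  have hcoeff : (p * q).coeff g = ∑ h : Γ, p.coeff h * q.coeff (h⁻¹ * g) := by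
    rw [MonoidAlgebra.coeff_mul_apply_left, Finsupp.sum_fintype _ _ (by simp)]
  simp only [dualMulAdj_single, map_smul, map_sum, TensorProduct.map_tmul, convolution_single,
    LinearMap.mul'_apply, smul_mul_smul_comm, MonoidAlgebra.single_mul_single,
    mul_inv_cancel_left, mul_one, ← Finset.sum_smul, smul_smul, one_mul]
  rw [hcoeff, Finset.mul_sum, Finset.mul_sum]
  refine congrArg (· • _) (Finset.sum_congr rfl fun h _ => ?_)
  field_simp

theorem star_convolution_star (p x : MonoidAlgebra ℂ Γ) :
    star ((dualQuantumSet Γ).convolution p (star x))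
      = (dualQuantumSet Γ).convolution (star p) x := by
  induction x using MonoidAlgebra.induction_linear with
  | zero => simp
  | add x y hx hy => simp only [star_add, map_add, hx, hy]
  | single g c =>
    rw [groupAlgebra_star_single, convolution_single, convolution_single, star_smul,
      groupAlgebra_star_single, inv_inv, star_star, star_mul', groupAlgebra_coeff_star,
      star_natCast]

/-- The quantum Cayley graph `x ↦ p ⋆ x` on the dual of a finite group. -/
noncomputable def dualCayleyGraph (hp : IsStarProjection p) : QuantumGraph (dualQuantumSet Γ) where
  A := (dualQuantumSet Γ).convolution p
  schur_idempotent := by rw [schur_convolution, hp.isIdempotentElem.eq]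
  real f := by rw [star_convolution_star, hp.isSelfAdjoint.star_eq]

theorem dualCayleyGraph_single (hp : IsStarProjection p) (g : Γ) (c : ℂ) :
    (dualCayleyGraph hp).A (MonoidAlgebra.single g c)
      = (Fintype.card Γ * p.coeff g) • MonoidAlgebra.single g c :=
  convolution_single p g c

end CayleyGraph

section TensorCoeff

variable {Γ K : Type*} [Ring K] [Algebra ℂ K]

/-- The coefficient in `K` of `g : Γ` in an element of `ℂ[Γ] ⊗ K`. -/
noncomputable def tensorCoeff (g : Γ) : MonoidAlgebra ℂ Γ ⊗[ℂ] K →ₗ[ℂ] K :=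
  (TensorProduct.lid ℂ K).toLinearMap ∘ₗ LinearMap.rTensor K ((MonoidAlgebra.basis Γ ℂ).coord g)

theorem tensorCoeff_tmul (g : Γ) (x : MonoidAlgebra ℂ Γ) (a : K) :
    tensorCoeff g (x ⊗ₜ[ℂ] a) = x.coeff g • a := rfl

theorem single_tmul_injective (g : Γ) :
    Function.Injective fun a : K => MonoidAlgebra.single g (1 : ℂ) ⊗ₜ[ℂ] a :=
  Function.LeftInverse.injective (g := tensorCoeff g) fun a => by simp [tensorCoeff_tmul]

variable [Fintype Γ]

theorem sum_single_tmul_tensorCoeff (t : MonoidAlgebra ℂ Γ ⊗[ℂ] K) :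
    ∑ g : Γ, MonoidAlgebra.single g (1 : ℂ) ⊗ₜ[ℂ] tensorCoeff g t = t := by
  classical
  induction t using TensorProduct.induction_on with
  | zero => simp
  | add x y hx hy => simp only [map_add, TensorProduct.tmul_add, Finset.sum_add_distrib, hx, hy]
  | tmul x a =>
    simp only [tensorCoeff_tmul, ← TensorProduct.smul_tmul, ← TensorProduct.sum_tmul]
    congr 1
    ext h
    simp

variable [Group Γ] {p : MonoidAlgebra ℂ Γ}

theorem tensorCoeff_rTensor_dualCayleyGraph (hp : IsStarProjection p) (g : Γ)
    (t : MonoidAlgebra ℂ Γ ⊗[ℂ] K) :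
    tensorCoeff g (LinearMap.rTensor K (dualCayleyGraph hp).A t)
      = (Fintype.card Γ * p.coeff g) • tensorCoeff g t := by
  classical
  conv_lhs => rw [← sum_single_tmul_tensorCoeff t]
  simp only [map_sum, LinearMap.rTensor_tmul, dualCayleyGraph_single, tensorCoeff_tmul]
  rw [Finset.sum_eq_single_of_mem g (Finset.mem_univ g) fun h _ hne => by simp [hne]]
  simp

end TensorCoeff

section DiagonalHoms

variable {Γ K : Type*} [Group Γ] [Ring K] [Algebra ℂ K]

theorem exists_monoidHom_of_map_single
    {φ : MonoidAlgebra ℂ Γ →ₐ[ℂ] MonoidAlgebra ℂ Γ ⊗[ℂ] K}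
    (hφ : ∀ g, ∃ a : K, φ (MonoidAlgebra.single g 1) = MonoidAlgebra.single g 1 ⊗ₜ[ℂ] a) :
    ∃ f : Γ →* K, ∀ g, φ (MonoidAlgebra.single g 1) = MonoidAlgebra.single g 1 ⊗ₜ[ℂ] f g := by
  choose f hf using hφ
  have map_one : f 1 = 1 := single_tmul_injective (1 : Γ) <| by
    simp only [← hf]
    simp [← MonoidAlgebra.one_def, Algebra.TensorProduct.one_def]
  have map_mul (g h : Γ) : f (g * h) = f g * f h := single_tmul_injective (g * h) <| by
    have hgh := map_mul φ (MonoidAlgebra.single g 1) (MonoidAlgebra.single h 1)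
    simpa only [MonoidAlgebra.single_mul_single, mul_one, hf,
      Algebra.TensorProduct.tmul_mul_tmul] using hgh
  exact ⟨⟨⟨f, map_one⟩, map_mul⟩, hf⟩

variable [Fintype Γ] {p : MonoidAlgebra ℂ Γ}

theorem SeparatesNoncentral.map_single_of_notMem_center (hp : IsStarProjection p)
    (hsep : SeparatesNoncentral p) {φ : MonoidAlgebra ℂ Γ →ₗ[ℂ] MonoidAlgebra ℂ Γ ⊗[ℂ] K}
    (hφ : ∀ x, LinearMap.rTensor K (dualCayleyGraph hp).A (φ x) = φ ((dualCayleyGraph hp).A x))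
    {g : Γ} (hg : g ∉ Subgroup.center Γ) :
    ∃ a : K, φ (MonoidAlgebra.single g 1) = MonoidAlgebra.single g 1 ⊗ₜ[ℂ] a := by
  set t := φ (MonoidAlgebra.single g 1) with ht
  have hcard : (Fintype.card Γ : ℂ) ≠ 0 := Nat.cast_ne_zero.mpr Fintype.card_ne_zero
  have heigen : LinearMap.rTensor K (dualCayleyGraph hp).A t
      = (Fintype.card Γ * p.coeff g) • t := by
    rw [ht, hφ, dualCayleyGraph_single, map_smul]
  have hcoeff (h : Γ) (hne : h ≠ g) : tensorCoeff h t = 0 := by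
    have hsmul := tensorCoeff_rTensor_dualCayleyGraph hp h t
    rw [heigen, map_smul, ← sub_eq_zero, ← sub_smul, ← mul_sub, smul_eq_zero] at hsmul
    exact hsmul.resolve_left (mul_ne_zero hcard (sub_ne_zero.mpr (hsep g hg h hne).symm))
  refine ⟨tensorCoeff g t, (sum_single_tmul_tensorCoeff t).symm.trans ?_⟩
  exact Finset.sum_eq_single_of_mem g (Finset.mem_univ g) fun h _ hne => by
    rw [hcoeff h hne, TensorProduct.tmul_zero]

theorem SeparatesNoncentral.exists_monoidHom (hp : IsStarProjection p)
    (hsep : SeparatesNoncentral p)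
    (hΓ : Submonoid.closure (Subgroup.center Γ : Set Γ)ᶜ = ⊤)
    {φ : MonoidAlgebra ℂ Γ →ₐ[ℂ] MonoidAlgebra ℂ Γ ⊗[ℂ] K}
    (hφ : ∀ x, LinearMap.rTensor K (dualCayleyGraph hp).A (φ x) = φ ((dualCayleyGraph hp).A x)) :
    ∃ f : Γ →* K, ∀ g, φ (MonoidAlgebra.single g 1) = MonoidAlgebra.single g 1 ⊗ₜ[ℂ] f g := by
  refine exists_monoidHom_of_map_single fun g => ?_
  induction hΓ ▸ Submonoid.mem_top g using Submonoid.closure_induction with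
  | mem g hg => exact hsep.map_single_of_notMem_center hp (φ := φ.toLinearMap) hφ hg
  | one => exact ⟨1, by rw [← MonoidAlgebra.one_def, map_one, Algebra.TensorProduct.one_def]⟩
  | mul g h _ _ hg hh =>
    obtain ⟨a, ha⟩ := hg
    obtain ⟨b, hb⟩ := hh
    refine ⟨a * b, ?_⟩
    have hgh : MonoidAlgebra.single (g * h) (1 : ℂ)
        = MonoidAlgebra.single g 1 * MonoidAlgebra.single h 1 := by
      rw [MonoidAlgebra.single_mul_single, mul_one]
    rw [hgh, map_mul, ha, hb, Algebra.TensorProduct.tmul_mul_tmul]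

end DiagonalHoms

section ClassicalAutomorphisms

variable {Γ : Type*} [Group Γ] [Fintype Γ] {p : MonoidAlgebra ℂ Γ}

theorem classicalAut_dualCayleyGraph (hΓ : Group.IsPerfect Γ) (hp : IsStarProjection p)
    (hsep : SeparatesNoncentral p) : (dualCayleyGraph hp).classicalAut = ⊥ := by
  refine eq_bot_iff.mpr fun θ hθ => Subgroup.mem_bot.mpr ?_
  change ∀ x, θ ((dualCayleyGraph hp).A x) = (dualCayleyGraph hp).A (θ x) at hθ
  let φ : MonoidAlgebra ℂ Γ →ₐ[ℂ] MonoidAlgebra ℂ Γ ⊗[ℂ] ℂ :=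
    Algebra.TensorProduct.includeLeft.comp
      (θ : MonoidAlgebra ℂ Γ →⋆ₐ[ℂ] MonoidAlgebra ℂ Γ).toAlgHom
  have hφ (x : MonoidAlgebra ℂ Γ) : φ x = θ x ⊗ₜ[ℂ] (1 : ℂ) := rfl
  obtain ⟨f, hf⟩ := hsep.exists_monoidHom hp (closure_compl_center_of_isPerfect hΓ) (φ := φ)
    fun x => by rw [hφ, hφ, LinearMap.rTensor_tmul, hθ]
  have hθ_single (g : Γ) : θ (MonoidAlgebra.single g 1) = MonoidAlgebra.single g 1 := by
    have h := congrArg (TensorProduct.rid ℂ _) (hf g)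
    rwa [hφ, map_eq_one_of_isPerfect hΓ f, TensorProduct.rid_tmul, TensorProduct.rid_tmul,
      one_smul, one_smul] at h
  have hθ_id : (θ : MonoidAlgebra ℂ Γ →⋆ₐ[ℂ] MonoidAlgebra ℂ Γ).toAlgHom = AlgHom.id ℂ _ :=
    MonoidAlgebra.algHom_ext hθ_single (Subsingleton.elim _ _)
  exact StarAlgEquiv.ext fun x => DFunLike.congr_fun hθ_id x

end ClassicalAutomorphisms

section QuantumAutomorphisms

theorem regular_single {Γ : Type*} [Group Γ] (g : Γ) (c : ℂ) :
    (QuantumAction.regular (MonoidAlgebra ℂ Γ)).hom (MonoidAlgebra.single g c)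
      = MonoidAlgebra.single g 1 ⊗ₜ[ℂ] MonoidAlgebra.single g c := by
  change Coalgebra.comul (R := ℂ) (A := MonoidAlgebra ℂ Γ) _ = _
  have h : MonoidAlgebra.single g c = c • MonoidAlgebra.single g (1 : ℂ) := by simp
  rw [h, map_smul, TensorProduct.tmul_smul]
  simp

theorem isPreservedBy_regular {Γ : Type*} [Group Γ] [Fintype Γ] {p : MonoidAlgebra ℂ Γ}
    (hp : IsStarProjection p) :
    (dualCayleyGraph hp).IsPreservedBy (QuantumAction.regular (MonoidAlgebra ℂ Γ)) where
  functional x := by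
    classical
    induction x using MonoidAlgebra.induction_linear with
    | zero => simp
    | add x y hx hy => simp only [map_add, hx, hy, add_smul]
    | single g c =>
      rw [regular_single, LinearMap.rTensor_tmul, TensorProduct.lid_tmul]
      change dualHaar Γ _ • _ = dualHaar Γ _ • _
      rw [dualHaar_single, dualHaar_single]
      split_ifs with hg
      · subst hg
        simp [MonoidAlgebra.one_def]
      · simp
  adjacency x := by
    induction x using MonoidAlgebra.induction_linear with
    | zero => simp
    | add x y hx hy => simp only [map_add, hx, hy]
    | single g c =>
      rw [regular_single, LinearMap.rTensor_tmul, dualCayleyGraph_single, dualCayleyGraph_single,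
        map_smul, regular_single, TensorProduct.smul_tmul']

theorem isGroupLikeElem_of_isUnit {R A : Type*} [CommSemiring R] [Semiring A] [Bialgebra R A]
    {a : A} (ha : IsUnit a) (hcomul : Coalgebra.comul (R := R) a = a ⊗ₜ[R] a) :
    IsGroupLikeElem R a where
  comul_eq_tmul_self := hcomul
  counit_eq_one := by
    have hsmul : Coalgebra.counit (R := R) a • a = a := by
      have h := congrArg (TensorProduct.lid R A) (Coalgebra.rTensor_counit_comul (R := R) a)
      rwa [hcomul, LinearMap.rTensor_tmul, TensorProduct.lid_tmul, TensorProduct.lid_tmul,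
        one_smul] at h
    have hunit : IsUnit (Coalgebra.counit (R := R) a) := ha.map (Bialgebra.counitAlgHom R A)
    refine hunit.mul_left_cancel ?_
    have h := congrArg (Coalgebra.counit (R := R)) hsmul
    rw [map_smul, smul_eq_mul] at h
    exact h.trans (mul_one _).symm

variable {Γ K : Type*} [Group Γ] [Ring K] [StarRing K] [HopfAlgebra ℂ K] [StarModule ℂ K]
  {β : QuantumAction (MonoidAlgebra ℂ Γ) K} {f : Γ →* K}

theorem isGroupLikeElem_of_map_single
    (hf : ∀ g, β.hom (MonoidAlgebra.single g 1) = MonoidAlgebra.single g 1 ⊗ₜ[ℂ] f g) (g : Γ) :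
    IsGroupLikeElem ℂ (f g) := by
  refine isGroupLikeElem_of_isUnit ((Group.isUnit g).map f) (single_tmul_injective g ?_)
  have h := β.action_eq (MonoidAlgebra.single g 1)
  rw [hf, LinearMap.rTensor_tmul, LinearMap.lTensor_tmul] at h
  refine h.symm.trans ?_
  change TensorProduct.assoc ℂ _ K K (β.hom (MonoidAlgebra.single g 1) ⊗ₜ[ℂ] f g) = _
  rw [hf, TensorProduct.assoc_tmul]

theorem map_inv_eq_star_of_map_single
    (hf : ∀ g, β.hom (MonoidAlgebra.single g 1) = MonoidAlgebra.single g 1 ⊗ₜ[ℂ] f g) (g : Γ) :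
    f g⁻¹ = star (f g) := by
  have h := map_star β.hom (MonoidAlgebra.single g 1)
  rw [groupAlgebra_star_single, star_one, hf, hf, TensorProduct.star_tmul,
    groupAlgebra_star_single, star_one] at h
  exact single_tmul_injective g⁻¹ h

theorem exists_bialgHom_single {R A G : Type*} [CommSemiring R] [Semiring A] [Bialgebra R A]
    [Monoid G] {f : G →* A} (hf : ∀ g, IsGroupLikeElem R (f g)) :
    ∃ γ : MonoidAlgebra R G →ₐc[R] A, ∀ g c, γ (MonoidAlgebra.single g c) = c • f g := by
  let f' : G →* GroupLike R A :=
    { toFun g := ⟨f g, hf g⟩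
      map_one' := GroupLike.ext (map_one f)
      map_mul' g h := GroupLike.ext (map_mul f g h) }
  exact ⟨MonoidAlgebra.liftGroupLikeBialgHom.comp (MonoidAlgebra.mapDomainBialgHom R f'),
    fun g c => by simp [f']⟩

theorem lTensor_regular_eq_iff
    (hf : ∀ g, β.hom (MonoidAlgebra.single g 1) = MonoidAlgebra.single g 1 ⊗ₜ[ℂ] f g)
    (γ : MonoidAlgebra ℂ Γ →ₐc[ℂ] K) :
    (∀ x, LinearMap.lTensor (MonoidAlgebra ℂ Γ) (γ : MonoidAlgebra ℂ Γ →ₗ[ℂ] K)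
      ((QuantumAction.regular (MonoidAlgebra ℂ Γ)).hom x) = β.hom x) ↔
      ∀ g, γ (MonoidAlgebra.single g 1) = f g := by
  have hsingle (g : Γ) : LinearMap.lTensor (MonoidAlgebra ℂ Γ) (γ : MonoidAlgebra ℂ Γ →ₗ[ℂ] K)
      ((QuantumAction.regular (MonoidAlgebra ℂ Γ)).hom (MonoidAlgebra.single g 1))
        = MonoidAlgebra.single g 1 ⊗ₜ[ℂ] γ (MonoidAlgebra.single g 1) := by
    rw [regular_single, LinearMap.lTensor_tmul]
    rfl
  refine ⟨fun h g => single_tmul_injective g ?_, fun h x => ?_⟩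
  · exact (hsingle g).symm.trans ((h _).trans (hf g))
  · induction x using MonoidAlgebra.induction_linear with
    | zero => simp
    | add x y hx hy => simp only [map_add, hx, hy]
    | single g c =>
      have hc : MonoidAlgebra.single g c = c • MonoidAlgebra.single g (1 : ℂ) := by simp
      rw [hc, map_smul, map_smul, map_smul, hsingle, h, hf]

theorem existsUnique_bialgHom [Fintype Γ] {p : MonoidAlgebra ℂ Γ} (hp : IsStarProjection p)
    (hsep : SeparatesNoncentral p) (hΓ : Submonoid.closure (Subgroup.center Γ : Set Γ)ᶜ = ⊤)
    (β : QuantumAction (MonoidAlgebra ℂ Γ) K) (hβ : (dualCayleyGraph hp).IsPreservedBy β) :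
    ∃! γ : MonoidAlgebra ℂ Γ →ₐc[ℂ] K, (∀ x, γ (star x) = star (γ x)) ∧
      ∀ x, LinearMap.lTensor (MonoidAlgebra ℂ Γ) (γ : MonoidAlgebra ℂ Γ →ₗ[ℂ] K)
        ((QuantumAction.regular (MonoidAlgebra ℂ Γ)).hom x) = β.hom x := by
  obtain ⟨f, hf⟩ := hsep.exists_monoidHom hp hΓ (φ := β.hom.toAlgHom) hβ.adjacency
  obtain ⟨γ, hγ⟩ := exists_bialgHom_single (isGroupLikeElem_of_map_single hf)
  refine ⟨γ, ⟨fun x => ?_, (lTensor_regular_eq_iff hf γ).mpr fun g => by rw [hγ, one_smul]⟩,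
    fun γ' hγ' => MonoidAlgebra.bialgHom_ext (fun g => ?_) (Subsingleton.elim _ _)⟩
  · induction x using MonoidAlgebra.induction_linear with
    | zero => simp
    | add x y hx hy => simp only [star_add, map_add, hx, hy]
    | single g c =>
      rw [groupAlgebra_star_single, hγ, hγ, star_smul, map_inv_eq_star_of_map_single hf]
  · rw [(lTensor_regular_eq_iff hf γ').mp hγ'.2 g, hγ, one_smul]

end QuantumAutomorphisms

theorem theoremC (Γ : Type u) [Group Γ] [Fintype Γ] (hΓ : Group.IsPerfect Γ) :
    ∃ G : QuantumGraph (dualQuantumSet Γ),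
      G.IsCayley ∧
      G.classicalAut = ⊥ ∧
      QuantumGraph.IsQuantumAutGroup.{v} G (QuantumAction.regular (MonoidAlgebra ℂ Γ)) ∧
      (QuantumAction.regular (MonoidAlgebra ℂ Γ)).IsErgodic := by
  obtain ⟨p, hp, hsep⟩ := exists_isStarProjection_separatesNoncentral Γ
  have hgen := closure_compl_center_of_isPerfect hΓ
  exact ⟨dualCayleyGraph hp, ⟨p, hp, rfl⟩, classicalAut_dualCayleyGraph hΓ hp hsep,
    { compactQuantumGroup := inferInstance
      preserved := isPreservedBy_regular hp
      faithful := QuantumAction.isFaithful_regular _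
      universal := fun _ _ _ _ _ _ β hβ => existsUnique_bialgHom hp hsep hgen β hβ },
    QuantumAction.isErgodic_regular _⟩
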